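/- Let $d\ge 1$. For a bounded open set $\Omega\subset\mathbb{R}^d$ and an integer $h\ge 1$, let $$\Lambda_h(\Omega)=\min_{V\subset H_0^2(\Omega),\ \dim V=h}\ \max_{u\in V\setminus\{0\}}\frac{\int_\Omega(\Delta u)^2\,dx}{\int_\Omega|\nabla u|^2\,dx}$$ be the $h$-th buckling eigenvalue of $\Omega$, where $V$ ranges over the $h$-dimensional linear subspaces of $H^2_0(\Omega)$, the closure of $C_c^\infty(\Omega)$ in $H^2(\Omega)$ (with $\Lambda_h(\emptyset)=+\infty$). For open sets $A,B\subset\mathbb{R}^d$, let $d_{H^c}(A,B)=d_H(\mathbb{R}^d\setminus A,\mathbb{R}^d\setminus B)$, where $d_H(X,Y)=\max\{\sup_{x\in X}\operatorname{dist}(x,Y),\ \sup_{y\in Y}\operatorname{dist}(y,X)\}$ is the Hausdorff distance between closed sets. **Proposition.** Let $D\subset\mathbb{R}^d$ be compact, let $(\Omega_n)_n$ be a sequence of open convex sets and let $\Omega$ be a nonempty open convex set, with $\Omega_n\subset D$ for every $n$ and $\Omega\subset D$. If $d_{H^c}(\Omega_n,\Omega)\to 0$ as $n\to\infty$, then for every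 integer $h\ge 1$ $$\Lambda_h(\Omega)\le\liminf_{n\to+\infty}\Lambda_h(\Omega_n).$$ -/

import Mathlib

noncomputable section

namespace Buckling

open MeasureTheory TopologicalSpace Filter
open scoped Distributions ENNReal

/-- The Euclidean space `ℝ^d`. -/
abbrev E (d : ℕ) : Type := EuclideanSpace ℝ (Fin d)

/-- The Lebesgue space `L²(Ω)` of (classes of) square-summable real functions on `Ω`. -/
abbrev L2 {d : ℕ} (Ω : Opens (E d)) : Type :=
  Lp ℝ 2 ((volume : Measure (E d)).restrict (Ω : Set (E d)))

/-- The partial derivative `∂_i φ` of a test function `φ ∈ C_c^∞(Ω)`. -/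
def pderiv {d : ℕ} {Ω : Opens (E d)} (i : Fin d) (φ : 𝓓(Ω, ℝ)) : 𝓓(Ω, ℝ) where
  toFun := fun x => fderiv ℝ φ x (EuclideanSpace.single i 1)
  contDiff' := by
    have h : ContDiff ℝ ((⊤ : ℕ∞) : WithTop ℕ∞) φ := φ.contDiff
    exact (h.fderiv_right (by simp)).clm_apply contDiff_const
  hasCompactSupport' := φ.hasCompactSupport.fderiv_apply ℝ _
  tsupport_subset' := (tsupport_fderiv_apply_subset ℝ _).trans φ.tsupport_subset

theorem pderiv_apply {d : ℕ} {Ω : Opens (E d)} (i : Fin d) (φ : 𝓓(Ω, ℝ)) (x : E d) :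
    pderiv i φ x = fderiv ℝ φ x (EuclideanSpace.single i 1) := rfl

theorem pderiv_add {d : ℕ} {Ω : Opens (E d)} (i : Fin d) (φ ψ : 𝓓(Ω, ℝ)) :
    pderiv i (φ + ψ) = pderiv i φ + pderiv i ψ := by
  ext x
  have h1 : DifferentiableAt ℝ φ x := φ.contDiff.differentiable (by simp) x
  have h2 : DifferentiableAt ℝ ψ x := ψ.contDiff.differentiable (by simp) x
  simp only [pderiv_apply, FunLike.coe_add, Pi.add_apply]
  rw [fderiv_add h1 h2]
  rfl

theorem pderiv_smul {d : ℕ} {Ω : Opens (E d)} (i : Fin d) (c : ℝ) (φ : 𝓓(Ω, ℝ)) :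
    pderiv i (c • φ) = c • pderiv i φ := by
  ext x
  have h1 : DifferentiableAt ℝ φ x := φ.contDiff.differentiable (by simp) x
  simp only [pderiv_apply, FunLike.coe_smul, Pi.smul_apply]
  rw [fderiv_const_smul h1]
  rfl

theorem memLp_test {d : ℕ} {Ω : Opens (E d)} (φ : 𝓓(Ω, ℝ)) :
    MemLp φ 2 ((volume : Measure (E d)).restrict (Ω : Set (E d))) :=
  φ.continuous.memLp_of_hasCompactSupport φ.hasCompactSupport

/-- The class in `L²(Ω)` of a test function. -/
def testL2 {d : ℕ} (Ω : Opens (E d)) : 𝓓(Ω, ℝ) →ₗ[ℝ] L2 Ω where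
  toFun φ := (memLp_test φ).toLp φ
  map_add' φ ψ := MemLp.toLp_add (memLp_test φ) (memLp_test ψ)
  map_smul' c φ := MemLp.toLp_const_smul c (memLp_test φ)

theorem testL2_coe {d : ℕ} {Ω : Opens (E d)} (φ : 𝓓(Ω, ℝ)) :
    testL2 Ω φ =ᵐ[(volume : Measure (E d)).restrict (Ω : Set (E d))] φ :=
  MemLp.coeFn_toLp (memLp_test φ)

theorem integrable_mul_test {d : ℕ} {Ω : Opens (E d)} (u : L2 Ω) (φ : 𝓓(Ω, ℝ)) :
    Integrable (fun x => u x * φ x) ((volume : Measure (E d)).restrict (Ω : Set (E d))) :=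
  (Lp.memLp u).integrable_mul (memLp_test φ)

/-- `g ∈ L²(Ω)` is the weak `i`-th partial derivative of `u ∈ L²(Ω)`:
`∫_Ω u ∂_i φ = - ∫_Ω g φ` for every `φ ∈ C_c^∞(Ω)`. -/
def IsWeakPDeriv {d : ℕ} {Ω : Opens (E d)} (i : Fin d) (u g : L2 Ω) : Prop :=
  ∀ φ : 𝓓(Ω, ℝ),
    ∫ x in (Ω : Set (E d)), u x * pderiv i φ x = -∫ x in (Ω : Set (E d)), g x * φ x

theorem isWeakPDeriv_zero {d : ℕ} {Ω : Opens (E d)} (i : Fin d) :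
    IsWeakPDeriv i (0 : L2 Ω) 0 := by
  intro φ
  have h : ∀ ψ : 𝓓(Ω, ℝ), ∫ x in (Ω : Set (E d)), (0 : L2 Ω) x * ψ x = 0 := by
    intro ψ
    refine integral_eq_zero_of_ae ?_
    filter_upwards [Lp.coeFn_zero ℝ 2 ((volume : Measure (E d)).restrict (Ω : Set (E d)))]
      with x hx
    rw [hx, Pi.zero_apply, zero_mul]
  rw [h, h, neg_zero]

theorem integral_add_mul {d : ℕ} {Ω : Opens (E d)} (u v : L2 Ω) (ψ : 𝓓(Ω, ℝ)) :
    ∫ x in (Ω : Set (E d)), (u + v) x * ψ x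
      = (∫ x in (Ω : Set (E d)), u x * ψ x) + ∫ x in (Ω : Set (E d)), v x * ψ x := by
  rw [← integral_add (integrable_mul_test u ψ) (integrable_mul_test v ψ)]
  refine integral_congr_ae ?_
  filter_upwards [Lp.coeFn_add u v] with x hx
  rw [hx, Pi.add_apply, add_mul]

theorem integral_smul_mul {d : ℕ} {Ω : Opens (E d)} (c : ℝ) (u : L2 Ω) (ψ : 𝓓(Ω, ℝ)) :
    ∫ x in (Ω : Set (E d)), (c • u) x * ψ x = c * ∫ x in (Ω : Set (E d)), u x * ψ x := by
  rw [← integral_const_mul]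
  refine integral_congr_ae ?_
  filter_upwards [Lp.coeFn_smul c u] with x hx
  rw [hx, Pi.smul_apply, smul_eq_mul, mul_assoc]

theorem IsWeakPDeriv.add {d : ℕ} {Ω : Opens (E d)} {i : Fin d} {u g v k : L2 Ω}
    (h1 : IsWeakPDeriv i u g) (h2 : IsWeakPDeriv i v k) : IsWeakPDeriv i (u + v) (g + k) := by
  intro φ
  rw [integral_add_mul, integral_add_mul, h1 φ, h2 φ, neg_add]

theorem IsWeakPDeriv.smul {d : ℕ} {Ω : Opens (E d)} {i : Fin d} {u g : L2 Ω} (c : ℝ)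
    (h : IsWeakPDeriv i u g) : IsWeakPDeriv i (c • u) (c • g) := by
  intro φ
  rw [integral_smul_mul, integral_smul_mul, h φ, mul_neg]

/-- Integration by parts: classical derivatives of test functions are weak derivatives. -/
theorem isWeakPDeriv_test {d : ℕ} {Ω : Opens (E d)} (i : Fin d) (φ : 𝓓(Ω, ℝ)) :
    IsWeakPDeriv i (testL2 Ω φ) (testL2 Ω (pderiv i φ)) := by
  intro ψ
  have key : ∀ a b : 𝓓(Ω, ℝ), ∫ x in (Ω : Set (E d)), (testL2 Ω a) x * b x
      = ∫ x, a x * b x := by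
    intro a b
    rw [integral_congr_ae (g := fun x => a x * b x)
      (by filter_upwards [testL2_coe a] with x hx; rw [hx])]
    refine setIntegral_eq_integral_of_forall_compl_eq_zero ?_
    intro x hx
    have : a x = 0 := by
      by_contra h
      exact hx (a.tsupport_subset (subset_tsupport _ h))
    rw [this, zero_mul]
  have hint : ∀ a b : 𝓓(Ω, ℝ), Integrable (fun x => a x * b x) (volume : Measure (E d)) := by
    intro a b
    exact (a.continuous.mul b.continuous).integrable_of_hasCompactSupport
      a.hasCompactSupport.mul_right
  rw [key, key]
  exact integral_mul_fderiv_eq_neg_fderiv_mul_of_integrable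
    (hint (pderiv i φ) ψ) (hint φ (pderiv i ψ)) (hint φ ψ)
    (fun x _ => φ.contDiff.differentiable (by simp) x)
    (fun x _ => ψ.contDiff.differentiable (by simp) x)

/-- The Sobolev space `H²(Ω)`. An element is a function `u ∈ L²(Ω)` listed together with its
weak first derivatives `∂_i u ∈ L²(Ω)` and its weak second derivatives `∂_j ∂_i u ∈ L²(Ω)`
(which are determined by `u`). The topology induced by the product is that of the usual
`H²`-norm. -/
def H2 {d : ℕ} (Ω : Opens (E d)) :
    Submodule ℝ (L2 Ω × (Fin d → L2 Ω) × (Fin d → Fin d → L2 Ω)) where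
  carrier := {u | (∀ i, IsWeakPDeriv i u.1 (u.2.1 i)) ∧
    ∀ i j, IsWeakPDeriv j (u.2.1 i) (u.2.2 i j)}
  zero_mem' := ⟨fun i => isWeakPDeriv_zero i, fun _ j => isWeakPDeriv_zero j⟩
  add_mem' := fun hu hv => ⟨fun i => (hu.1 i).add (hv.1 i), fun i j => (hu.2 i j).add (hv.2 i j)⟩
  smul_mem' := fun c _ hu => ⟨fun i => (hu.1 i).smul c, fun i j => (hu.2 i j).smul c⟩

/-- The weak partial derivative `∂_i u ∈ L²(Ω)` of `u ∈ H²(Ω)`. -/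
def grad {d : ℕ} {Ω : Opens (E d)} (u : H2 Ω) (i : Fin d) : L2 Ω := u.1.2.1 i

/-- The weak second derivative `∂_j ∂_i u ∈ L²(Ω)` of `u ∈ H²(Ω)`. -/
def hess {d : ℕ} {Ω : Opens (E d)} (u : H2 Ω) (i j : Fin d) : L2 Ω := u.1.2.2 i j

/-- The inclusion `C_c^∞(Ω) ⊆ H²(Ω)`. -/
def testH2 {d : ℕ} (Ω : Opens (E d)) : 𝓓(Ω, ℝ) →ₗ[ℝ] H2 Ω where
  toFun φ := ⟨(testL2 Ω φ, fun i => testL2 Ω (pderiv i φ),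
      fun i j => testL2 Ω (pderiv j (pderiv i φ))),
    ⟨fun i => isWeakPDeriv_test i φ, fun i j => isWeakPDeriv_test j (pderiv i φ)⟩⟩
  map_add' φ ψ := by
    refine Subtype.ext ?_
    simp only [pderiv_add, map_add]
    rfl
  map_smul' c φ := by
    refine Subtype.ext ?_
    simp only [pderiv_smul, map_smul]
    rfl

/-- `H²₀(Ω)`: the closure of `C_c^∞(Ω)` in `H²(Ω)`. -/
def H20 {d : ℕ} (Ω : Opens (E d)) : Submodule ℝ (H2 Ω) :=
  (LinearMap.range (testH2 Ω)).topologicalClosure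

/-- The Rayleigh quotient `∫_Ω (Δu)² / ∫_Ω |∇u|²`, with values in `[0, ∞]`. -/
def rayleigh {d : ℕ} {Ω : Opens (E d)} (u : H2 Ω) : ℝ≥0∞ :=
  ENNReal.ofReal (∫ x in (Ω : Set (E d)), (∑ i, hess u i i x) ^ 2) /
    ENNReal.ofReal (∫ x in (Ω : Set (E d)), ∑ i, (grad u i x) ^ 2)

/-- The `h`-th buckling eigenvalue
`Λ_h(Ω) = min_{V ⊆ H²₀(Ω), dim V = h} max_{u ∈ V \ {0}} ∫_Ω (Δu)² / ∫_Ω |∇u|²`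
(it is `∞` if there is no such `V`, for instance if `Ω` is empty and `h ≥ 1`). -/
def Lam {d : ℕ} (h : ℕ) (Ω : Opens (E d)) : ℝ≥0∞ :=
  ⨅ (V : Submodule ℝ (H2 Ω)) (_ : V ≤ H20 Ω) (_ : Module.finrank ℝ V = h),
    ⨆ (u : H2 Ω) (_ : u ∈ V) (_ : u ≠ 0), rayleigh u

/-- The Hausdorff-complementary distance `d_{H^c}(A, B) = d_H(A^c, B^c)` between open sets. -/
def hausdorffComplEDist {d : ℕ} (A B : Opens (E d)) : ℝ≥0∞ :=
  Metric.hausdorffEDist ((A : Set (E d))ᶜ) ((B : Set (E d))ᶜ)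

end Buckling

end

/-!
The proof is by dilation and uses no compactness of Sobolev embeddings. Fix `x₀ ∈ Ω` and `t > 1`.

Convexity of the `Ωₙ` shows that eventually `Ωₙ ⊆ x₀ + t (Ω - x₀)`
(`Buckling.eventually_mem_of_homothety_mem`): a fixed ball about `x₀` lies in `Ωₙ` for large `n`, so
if `y ∈ Ωₙ`, the point `x = x₀ + (y - x₀) / t` is the centre of a ball contained in `Ωₙ` whose
radius does not depend on `n` or `y`. Hence `x` is far from the complement of `Ωₙ`, and therefore
cannot lie in the complement of `Ω`.

If `A ⊆ x₀ + t (Ω - x₀)`, then extending by zero and composing with `x ↦ x₀ + t (x - x₀)` maps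
`H²₀(A)` injectively and linearly into `H²₀(Ω)` (test functions go to test functions, and the map is
continuous), and it multiplies the Rayleigh quotient by `t²`. Hence `Λ_h(Ω) ≤ t² Λ_h(A)`
(`Buckling.Lam_le_of_dilation`).

Together, `t⁻² Λ_h(Ω) ≤ liminf Λ_h(Ωₙ)` for every `t > 1`, and `t → 1` gives the claim.
-/

noncomputable section

namespace Buckling

open MeasureTheory TopologicalSpace Filter
open scoped Distributions ENNReal

/-! ### Inner approximation in the Hausdorff-complementary topology -/

/-- If convex open sets `Ωs n` converge to `Ω ∋ x₀` in the Hausdorff-complementary sense, then for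
`t > 1` they are eventually contained in the dilation of `Ω` by `t` about `x₀`. -/
theorem eventually_mem_of_homothety_mem {d : ℕ} {Ωs : ℕ → Opens (E d)} {Ω : Opens (E d)}
    (hconv : ∀ n, Convex ℝ (Ωs n : Set (E d)))
    (hlim : Tendsto (fun n => hausdorffComplEDist (Ωs n) Ω) atTop (nhds 0))
    {x₀ : E d} (hx₀ : x₀ ∈ Ω) {t : ℝ} (ht : 1 < t) :
    ∀ᶠ n in atTop, ∀ x, x₀ + t • (x - x₀) ∈ Ωs n → x ∈ Ω := by
  obtain ⟨r, hr, hball⟩ := Metric.isOpen_iff.1 Ω.isOpen x₀ hx₀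
  have ht0 : 0 < t := by linarith
  have hs : 0 < 1 - t⁻¹ := by
    have := inv_lt_one_of_one_lt₀ ht
    linarith
  -- If `B(x₀, r/2)` and `x₀ + t (x - x₀)` lie in a convex set, so does `B(x, ρ)`.
  set ρ : ℝ := (1 - t⁻¹) * (r / 2) with hρ
  have hρ0 : 0 < ρ := by positivity
  filter_upwards [hlim.eventually_lt_const (ENNReal.ofReal_pos.2 hρ0)] with n hn x hx
  have hρr : ρ ≤ r / 2 := by
    have : 0 < t⁻¹ := by positivity
    nlinarith
  -- The half ball about `x₀` lies in `Ωs n`, as its points are far from the complement of `Ω`.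
  have hhalf : ∀ z, dist z x₀ < r / 2 → z ∈ Ωs n := by
    intro z hz
    by_contra hzn
    obtain ⟨w, hw, hzw⟩ := Metric.exists_edist_lt_of_hausdorffEDist_lt
      (s := ((Ωs n : Set (E d))ᶜ)) hzn hn
    refine hw (hball ?_)
    rw [edist_dist, ENNReal.ofReal_lt_ofReal_iff hρ0] at hzw
    rw [Metric.mem_ball]
    linarith [dist_triangle w z x₀, dist_comm w z]
  by_contra hxΩ
  -- By convexity `Ωs n` contains the ball of radius `ρ` about `x`.
  obtain ⟨w, hw, hxw⟩ := Metric.exists_edist_lt_of_hausdorffEDist_lt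
    (s := ((Ω : Set (E d))ᶜ)) (t := ((Ωs n : Set (E d))ᶜ)) hxΩ
    (by rw [Metric.hausdorffEDist_comm]; exact hn)
  rw [edist_dist, ENNReal.ofReal_lt_ofReal_iff hρ0] at hxw
  refine hw ?_
  have hz : x₀ + (1 - t⁻¹)⁻¹ • (w - x) ∈ Ωs n := by
    refine hhalf _ ?_
    rw [dist_eq_norm, add_sub_cancel_left, norm_smul, Real.norm_of_nonneg (by positivity),
      ← dist_eq_norm, dist_comm, inv_mul_lt_iff₀ hs]
    exact hxw
  have := hconv n hx hz (a := t⁻¹) (b := 1 - t⁻¹) (by positivity) hs.le (by ring)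
  convert this using 1
  simp only [smul_add, smul_smul, inv_mul_cancel₀ ht0.ne', mul_inv_cancel₀ hs.ne', one_smul,
    sub_smul]
  abel

/-! ### Dilations and Lebesgue measure -/

/-- The dilation `x ↦ t x + b` of `ℝ^d`, for `t > 0`. -/
def dilation {d : ℕ} {t : ℝ} (ht : 0 < t) (b : E d) : E d ≃ₜ E d :=
  (Homeomorph.smulOfNeZero t ht.ne').trans (Homeomorph.addRight b)

theorem dilation_apply {d : ℕ} {t : ℝ} (ht : 0 < t) (b x : E d) :
    dilation ht b x = t • x + b := rfl

theorem map_dilation_volume {d : ℕ} {t : ℝ} (ht : 0 < t) (b : E d) :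
    (volume : Measure (E d)).map (dilation ht b) = ENNReal.ofReal ((t ^ d)⁻¹) • volume := by
  have h : (dilation ht b : E d → E d) = (fun x => x + b) ∘ (fun x => t • x) := rfl
  rw [h, ← Measure.map_map (measurable_add_const b) (measurable_const_smul t),
    Measure.map_addHaar_smul volume ht.ne', Measure.map_smul, map_add_right_eq_self,
    finrank_euclideanSpace_fin, abs_of_pos (by positivity)]

theorem quasiMeasurePreserving_dilation {d : ℕ} {t : ℝ} (ht : 0 < t) (b : E d) :
    Measure.QuasiMeasurePreserving (dilation ht b) (volume : Measure (E d)) volume :=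
  ⟨(dilation ht b).measurable, by
    rw [map_dilation_volume]
    exact Measure.smul_absolutelyContinuous⟩

/-- Change of variables for a function on `A`, extended by zero and composed with a dilation
carrying the complement of `Ω` into the complement of `A`. -/
theorem setIntegral_indicator_dilation {d : ℕ} {A Ω : Opens (E d)} {t : ℝ} (ht : 0 < t) {b : E d}
    (hsub : ∀ x, dilation ht b x ∈ A → x ∈ Ω) (g : E d → ℝ) :
    ∫ x in (Ω : Set (E d)), (A : Set (E d)).indicator g (dilation ht b x)
      = (t ^ d)⁻¹ * ∫ x in (A : Set (E d)), g x := by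
  rw [setIntegral_eq_integral_of_forall_compl_eq_zero
    (fun x hx => Set.indicator_of_notMem (fun h => hx (hsub x h)) _)]
  simp only [dilation_apply]
  rw [Measure.integral_comp_smul volume (fun y => (A : Set (E d)).indicator g (y + b)) t,
    integral_add_right_eq_self (fun y => (A : Set (E d)).indicator g y),
    integral_indicator A.isOpen.measurableSet, finrank_euclideanSpace_fin,
    abs_of_pos (by positivity), smul_eq_mul]

/-! ### Pullback of functions under a dilation -/

theorem norm_sq_L2 {d : ℕ} {Ω : Opens (E d)} (u : L2 Ω) :
    ‖u‖ ^ 2 = ∫ x in (Ω : Set (E d)), u x ^ 2 := by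
  rw [← real_inner_self_eq_norm_sq, L2.inner_def]
  simp [sq]

theorem indicator_comp_dilation_congr {d : ℕ} {A Ω : Opens (E d)} {t : ℝ} (ht : 0 < t) {b : E d}
    {f g : E d → ℝ} (h : f =ᵐ[(volume : Measure (E d)).restrict (A : Set (E d))] g) :
    (fun x => (A : Set (E d)).indicator f (dilation ht b x))
      =ᵐ[(volume : Measure (E d)).restrict (Ω : Set (E d))]
      fun x => (A : Set (E d)).indicator g (dilation ht b x) :=
  ae_restrict_of_ae ((quasiMeasurePreserving_dilation ht b).ae_eq_comp
    ((ae_eq_restrict_iff_indicator_ae_eq A.isOpen.measurableSet).1 h))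

theorem memLp_indicator_dilation {d : ℕ} {A : Opens (E d)} (Ω : Opens (E d)) {t : ℝ} (ht : 0 < t)
    (b : E d) (u : L2 A) :
    MemLp (fun x => (A : Set (E d)).indicator u (dilation ht b x)) 2
      ((volume : Measure (E d)).restrict (Ω : Set (E d))) := by
  have h1 : MemLp ((A : Set (E d)).indicator u) 2 (volume : Measure (E d)) :=
    (memLp_indicator_iff_restrict A.isOpen.measurableSet).2 (Lp.memLp u)
  have h2 : MemLp ((A : Set (E d)).indicator u) 2
      ((volume : Measure (E d)).map (dilation ht b)) := by
    rw [map_dilation_volume]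
    exact h1.smul_measure ENNReal.ofReal_ne_top
  exact (h2.comp_of_map (dilation ht b).measurable.aemeasurable).restrict _

/-- The function `x ↦ u (t x + b)` in `L²(Ω)`, for `u ∈ L²(A)` extended by zero, as a linear
function of `u`. -/
def pullbackₗ {d : ℕ} (A Ω : Opens (E d)) {t : ℝ} (ht : 0 < t) (b : E d) : L2 A →ₗ[ℝ] L2 Ω where
  toFun u := (memLp_indicator_dilation Ω ht b u).toLp _
  map_add' u v := by
    rw [← MemLp.toLp_add, MemLp.toLp_eq_toLp_iff]
    refine (indicator_comp_dilation_congr ht (Lp.coeFn_add u v)).trans (ae_of_all _ fun x => ?_)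
    simp only [Set.indicator_add', Pi.add_apply]
  map_smul' c u := by
    rw [← MemLp.toLp_const_smul, MemLp.toLp_eq_toLp_iff]
    refine (indicator_comp_dilation_congr ht (Lp.coeFn_smul c u)).trans (ae_of_all _ fun x => ?_)
    simp only [Pi.smul_def, Set.indicator_const_smul_apply, RingHom.id_apply]

theorem pullbackₗ_coe {d : ℕ} {A Ω : Opens (E d)} {t : ℝ} (ht : 0 < t) (b : E d) (u : L2 A) :
    pullbackₗ A Ω ht b u =ᵐ[(volume : Measure (E d)).restrict (Ω : Set (E d))]
      fun x => (A : Set (E d)).indicator u (dilation ht b x) :=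
  MemLp.coeFn_toLp (memLp_indicator_dilation Ω ht b u)

/-- The change of variables `∫_Ω F((u_i(t x + b))_i) = t^{-d} ∫_A F((u_i)_i)` for a finite family of
functions and an integrand `F` with `F 0 = 0`. -/
theorem setIntegral_pullbackₗ {d : ℕ} {A Ω : Opens (E d)} {t : ℝ} (ht : 0 < t) {b : E d}
    (hsub : ∀ x, dilation ht b x ∈ A → x ∈ Ω) {ι : Type*} [Finite ι] (u : ι → L2 A)
    (F : (ι → ℝ) → ℝ) (hF : F 0 = 0) :
    ∫ x in (Ω : Set (E d)), F (fun i => pullbackₗ A Ω ht b (u i) x)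
      = (t ^ d)⁻¹ * ∫ x in (A : Set (E d)), F (fun i => u i x) := by
  rw [← setIntegral_indicator_dilation ht hsub]
  refine integral_congr_ae ?_
  filter_upwards [ae_all_iff.2 fun i => pullbackₗ_coe (Ω := Ω) ht b (u i)] with x hx
  simp only [hx]
  by_cases h : dilation ht b x ∈ (A : Set (E d))
  · simp only [Set.indicator_of_mem h]
  · simp only [Set.indicator_of_notMem h]
    exact hF

theorem norm_sq_pullbackₗ {d : ℕ} {A Ω : Opens (E d)} {t : ℝ} (ht : 0 < t) {b : E d}
    (hsub : ∀ x, dilation ht b x ∈ A → x ∈ Ω) (u : L2 A) :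
    ‖pullbackₗ A Ω ht b u‖ ^ 2 = (t ^ d)⁻¹ * ‖u‖ ^ 2 := by
  rw [norm_sq_L2, norm_sq_L2]
  exact setIntegral_pullbackₗ ht hsub (fun _ : Unit => u) (fun z => z () ^ 2) (by simp)

theorem pullbackₗ_injective {d : ℕ} {A Ω : Opens (E d)} {t : ℝ} (ht : 0 < t) {b : E d}
    (hsub : ∀ x, dilation ht b x ∈ A → x ∈ Ω) :
    Function.Injective (pullbackₗ A Ω ht b) := by
  rw [injective_iff_map_eq_zero]
  intro u hu
  have h := norm_sq_pullbackₗ ht hsub u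
  have ht' : (t ^ d)⁻¹ ≠ 0 := by positivity
  simpa [hu, ht'] using h.symm

theorem continuous_pullbackₗ {d : ℕ} {A Ω : Opens (E d)} {t : ℝ} (ht : 0 < t) {b : E d}
    (hsub : ∀ x, dilation ht b x ∈ A → x ∈ Ω) :
    Continuous (pullbackₗ A Ω ht b) := by
  refine AddMonoidHomClass.continuous_of_bound _ (√((t ^ d)⁻¹)) fun u => ?_
  rw [← Real.sqrt_sq (norm_nonneg (pullbackₗ A Ω ht b u)), norm_sq_pullbackₗ ht hsub,
    Real.sqrt_mul (by positivity), Real.sqrt_sq (norm_nonneg u)]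

/-- The test function `x ↦ φ (t x + b)`. -/
def testDilation {d : ℕ} {A Ω : Opens (E d)} {t : ℝ} (ht : 0 < t) {b : E d}
    (hsub : ∀ x, dilation ht b x ∈ A → x ∈ Ω) (φ : 𝓓(A, ℝ)) : 𝓓(Ω, ℝ) where
  toFun := fun x => φ (dilation ht b x)
  contDiff' := by
    simp only [dilation_apply]
    exact φ.contDiff.comp ((contDiff_id.const_smul t).add contDiff_const)
  hasCompactSupport' := φ.hasCompactSupport.comp_homeomorph (dilation ht b)
  tsupport_subset' := by
    refine (tsupport_comp_subset_preimage φ (dilation ht b).continuous).trans fun x hx => ?_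
    exact hsub x (φ.tsupport_subset hx)

theorem testDilation_apply {d : ℕ} {A Ω : Opens (E d)} {t : ℝ} (ht : 0 < t) {b : E d}
    (hsub : ∀ x, dilation ht b x ∈ A → x ∈ Ω) (φ : 𝓓(A, ℝ)) (x : E d) :
    testDilation ht hsub φ x = φ (dilation ht b x) := rfl

theorem pderiv_testDilation {d : ℕ} {A Ω : Opens (E d)} {t : ℝ} (ht : 0 < t) {b : E d}
    (hsub : ∀ x, dilation ht b x ∈ A → x ∈ Ω) (i : Fin d) (φ : 𝓓(A, ℝ)) :
    pderiv i (testDilation ht hsub φ) = t • testDilation ht hsub (pderiv i φ) := by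
  ext x
  have h1 : HasFDerivAt (dilation ht b) (t • ContinuousLinearMap.id ℝ (E d)) x :=
    ((hasFDerivAt_id x).const_smul t).add_const b
  have h2 : HasFDerivAt φ (fderiv ℝ φ (dilation ht b x)) (dilation ht b x) :=
    (φ.contDiff.differentiable (by simp) _).hasFDerivAt
  have h3 : HasFDerivAt (testDilation ht hsub φ) _ x := h2.comp x h1
  rw [pderiv_apply, h3.fderiv, FunLike.coe_smul, Pi.smul_apply, testDilation_apply, pderiv_apply]
  simp

theorem pullbackₗ_testL2 {d : ℕ} {A Ω : Opens (E d)} {t : ℝ} (ht : 0 < t) {b : E d}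
    (hsub : ∀ x, dilation ht b x ∈ A → x ∈ Ω) (φ : 𝓓(A, ℝ)) :
    pullbackₗ A Ω ht b (testL2 A φ) = testL2 Ω (testDilation ht hsub φ) := by
  refine Lp.ext ((pullbackₗ_coe ht b _).trans ?_)
  refine (indicator_comp_dilation_congr ht (testL2_coe φ)).trans ?_
  refine EventuallyEq.trans (ae_of_all _ fun x => ?_) (testL2_coe _).symm
  rw [Set.indicator_eq_self.2 ((subset_tsupport _).trans φ.tsupport_subset)]
  rfl

/-! ### Pullback of Sobolev functions -/

theorem continuous_setIntegral_mul_test {d : ℕ} {Ω : Opens (E d)} (φ : 𝓓(Ω, ℝ)) :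
    Continuous fun u : L2 Ω => ∫ x in (Ω : Set (E d)), u x * φ x := by
  have h : (fun u : L2 Ω => ∫ x in (Ω : Set (E d)), u x * φ x)
      = fun u => inner ℝ (testL2 Ω φ) u := by
    funext u
    rw [L2.inner_def]
    refine integral_congr_ae ?_
    filter_upwards [testL2_coe φ] with x hx
    simp [hx]
  rw [h]
  exact continuous_const.inner continuous_id

theorem isClosed_H2 {d : ℕ} (Ω : Opens (E d)) :
    IsClosed (H2 Ω : Set (L2 Ω × (Fin d → L2 Ω) × (Fin d → Fin d → L2 Ω))) := by
  have key : ∀ (i : Fin d)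
      {f g : L2 Ω × (Fin d → L2 Ω) × (Fin d → Fin d → L2 Ω) → L2 Ω},
      Continuous f → Continuous g → IsClosed {u | IsWeakPDeriv i (f u) (g u)} := by
    intro i f g hf hg
    simp only [IsWeakPDeriv, Set.ofPred_forall]
    exact isClosed_iInter fun φ => isClosed_eq
      ((continuous_setIntegral_mul_test _).comp hf) ((continuous_setIntegral_mul_test _).comp hg).neg
  have h : (H2 Ω : Set (L2 Ω × (Fin d → L2 Ω) × (Fin d → Fin d → L2 Ω)))
      = (⋂ i, {u | IsWeakPDeriv i u.1 (u.2.1 i)})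
        ∩ ⋂ i, ⋂ j, {u | IsWeakPDeriv j (u.2.1 i) (u.2.2 i j)} := by
    ext u
    simp [H2]
  rw [h]
  exact (isClosed_iInter fun i => key i (by fun_prop) (by fun_prop)).inter
    (isClosed_iInter fun i => isClosed_iInter fun j => key j (by fun_prop) (by fun_prop))

/-- The chain rule for `x ↦ u (t x + b)`, on triples (function, gradient, Hessian). -/
def jetPullback {d : ℕ} (A Ω : Opens (E d)) {t : ℝ} (ht : 0 < t) (b : E d) :
    (L2 A × (Fin d → L2 A) × (Fin d → Fin d → L2 A)) →ₗ[ℝ]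
      (L2 Ω × (Fin d → L2 Ω) × (Fin d → Fin d → L2 Ω)) where
  toFun u := (pullbackₗ A Ω ht b u.1, fun i => t • pullbackₗ A Ω ht b (u.2.1 i),
    fun i j => t ^ 2 • pullbackₗ A Ω ht b (u.2.2 i j))
  map_add' u v := by
    ext1
    · simp
    · ext1
      · funext i
        simp
      · funext i j
        simp
  map_smul' c u := by
    ext1
    · simp
    · ext1
      · funext i
        simp [smul_comm t c]
      · funext i j
        simp [smul_comm (t ^ 2) c]

theorem jetPullback_injective {d : ℕ} {A Ω : Opens (E d)} {t : ℝ} (ht : 0 < t) {b : E d}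
    (hsub : ∀ x, dilation ht b x ∈ A → x ∈ Ω) : Function.Injective (jetPullback A Ω ht b) := by
  have hinj := pullbackₗ_injective ht hsub
  intro u v huv
  simp only [jetPullback, LinearMap.coe_mk, AddHom.coe_mk, Prod.mk.injEq] at huv
  refine Prod.ext (hinj huv.1) (Prod.ext (funext fun i => hinj ?_)
    (funext fun i => funext fun j => hinj ?_))
  · exact smul_right_injective _ ht.ne' (congrFun huv.2.1 i)
  · exact smul_right_injective _ (pow_ne_zero 2 ht.ne') (congrFun (congrFun huv.2.2 i) j)

theorem continuous_jetPullback {d : ℕ} {A Ω : Opens (E d)} {t : ℝ} (ht : 0 < t) {b : E d}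
    (hsub : ∀ x, dilation ht b x ∈ A → x ∈ Ω) : Continuous (jetPullback A Ω ht b) := by
  have hc := continuous_pullbackₗ ht hsub
  refine Continuous.prodMk (hc.comp (by fun_prop)) (Continuous.prodMk ?_ ?_)
  · exact continuous_pi fun i => (hc.comp (by fun_prop)).const_smul t
  · exact continuous_pi fun i => continuous_pi fun j => (hc.comp (by fun_prop)).const_smul (t ^ 2)

theorem jetPullback_testH2 {d : ℕ} {A Ω : Opens (E d)} {t : ℝ} (ht : 0 < t) {b : E d}
    (hsub : ∀ x, dilation ht b x ∈ A → x ∈ Ω) (φ : 𝓓(A, ℝ)) :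
    jetPullback A Ω ht b (testH2 A φ) = testH2 Ω (testDilation ht hsub φ) := by
  simp only [jetPullback, testH2, LinearMap.coe_mk, AddHom.coe_mk, pullbackₗ_testL2 ht hsub,
    pderiv_testDilation, pderiv_smul, map_smul, smul_smul, sq]

/-- `H²₀(Ω)` is also the closure of the test functions in the ambient space of triples, since
`H²(Ω)` is closed there. -/
theorem exists_mem_H20_of_mem_closure {d : ℕ} {Ω : Opens (E d)}
    {w : L2 Ω × (Fin d → L2 Ω) × (Fin d → Fin d → L2 Ω)}
    (hw : w ∈ closure (Set.range fun φ : 𝓓(Ω, ℝ) => (testH2 Ω φ).1)) :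
    ∃ v ∈ H20 Ω, v.1 = w := by
  have hsub : Set.range (fun φ : 𝓓(Ω, ℝ) => (testH2 Ω φ).1) ⊆ H2 Ω := by
    rintro _ ⟨φ, rfl⟩
    exact (testH2 Ω φ).2
  refine ⟨⟨w, closure_minimal hsub (isClosed_H2 Ω) hw⟩, ?_, rfl⟩
  change _ ∈ closure (Set.range (testH2 Ω))
  rw [Topology.IsInducing.subtypeVal.closure_eq_preimage_closure_image, ← Set.range_comp]
  exact hw

theorem exists_mem_H20_eq_jetPullback {d : ℕ} {A Ω : Opens (E d)} {t : ℝ} (ht : 0 < t) {b : E d}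
    (hsub : ∀ x, dilation ht b x ∈ A → x ∈ Ω) {u : H2 A} (hu : u ∈ H20 A) :
    ∃ v ∈ H20 Ω, v.1 = jetPullback A Ω ht b u.1 := by
  refine exists_mem_H20_of_mem_closure ?_
  have hu' : u ∈ closure (Set.range (testH2 A)) := hu
  refine map_mem_closure (f := fun v : H2 A => jetPullback A Ω ht b v.1)
    ((continuous_jetPullback ht hsub).comp continuous_subtype_val) hu' ?_
  rintro _ ⟨φ, rfl⟩
  exact ⟨testDilation ht hsub φ, (jetPullback_testH2 ht hsub φ).symm⟩

/-- The numerator of the Rayleigh quotient scales by `t^{4-d}` and the denominator by `t^{2-d}`. -/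
theorem rayleigh_of_eq_jetPullback {d : ℕ} {A Ω : Opens (E d)} {t : ℝ} (ht : 0 < t) {b : E d}
    (hsub : ∀ x, dilation ht b x ∈ A → x ∈ Ω) {u : H2 A} {v : H2 Ω}
    (hv : v.1 = jetPullback A Ω ht b u.1) :
    rayleigh v = ENNReal.ofReal (t ^ 2) * rayleigh u := by
  have hg : ∀ i, grad v i = t • pullbackₗ A Ω ht b (grad u i) := fun i => by
    rw [grad, hv]; rfl
  have hh : ∀ i j, hess v i j = t ^ 2 • pullbackₗ A Ω ht b (hess u i j) := fun i j => by
    rw [hess, hv]; rfl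
  have h1 : ∫ x in (Ω : Set (E d)), (∑ i, hess v i i x) ^ 2
      = t ^ 2 * (t ^ 2 * (t ^ d)⁻¹) * ∫ x in (A : Set (E d)), (∑ i, hess u i i x) ^ 2 := by
    have := setIntegral_pullbackₗ ht hsub (fun i => hess u i i)
      (fun z => (∑ i, t ^ 2 * z i) ^ 2) (by simp)
    simp only [← Finset.mul_sum, mul_pow, integral_const_mul] at this
    have hae : ∫ x in (Ω : Set (E d)), (∑ i, hess v i i x) ^ 2
        = ∫ x in (Ω : Set (E d)), (t ^ 2) ^ 2 * (∑ i, pullbackₗ A Ω ht b (hess u i i) x) ^ 2 := by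
      refine integral_congr_ae ?_
      filter_upwards [ae_all_iff.2 fun i : Fin d =>
        Lp.coeFn_smul (t ^ 2) (pullbackₗ A Ω ht b (hess u i i))] with x hx
      simp only [hh, hx, Pi.smul_apply, smul_eq_mul, ← Finset.mul_sum, mul_pow]
    rw [hae, integral_const_mul, this]
    ring
  have h2 : ∫ x in (Ω : Set (E d)), ∑ i, (grad v i x) ^ 2
      = (t ^ 2 * (t ^ d)⁻¹) * ∫ x in (A : Set (E d)), ∑ i, (grad u i x) ^ 2 := by
    have := setIntegral_pullbackₗ ht hsub (grad u) (fun z => ∑ i, z i ^ 2) (by simp)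
    have hae : ∫ x in (Ω : Set (E d)), ∑ i, (grad v i x) ^ 2
        = ∫ x in (Ω : Set (E d)), t ^ 2 * ∑ i, (pullbackₗ A Ω ht b (grad u i) x) ^ 2 := by
      refine integral_congr_ae ?_
      filter_upwards [ae_all_iff.2 fun i : Fin d =>
        Lp.coeFn_smul t (pullbackₗ A Ω ht b (grad u i))] with x hx
      simp only [hg, hx, Pi.smul_apply, smul_eq_mul, mul_pow, Finset.mul_sum]
    rw [hae, integral_const_mul, this]
    ring
  have hc : 0 < t ^ 2 * (t ^ d)⁻¹ := by positivity
  rw [rayleigh, rayleigh, h1, h2, mul_assoc, ENNReal.ofReal_mul (by positivity),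
    ENNReal.ofReal_mul hc.le, ENNReal.ofReal_mul hc.le, mul_div_assoc,
    ENNReal.mul_div_mul_left _ _ (ENNReal.ofReal_pos.2 hc).ne' ENNReal.ofReal_ne_top]

/-! ### Buckling eigenvalues under dilation -/

/-- Monotonicity and scaling of the buckling eigenvalues combined: if `A` is contained in the image
of `Ω` under a dilation of ratio `t`, then `Λ_h(Ω) ≤ t² Λ_h(A)`. -/
theorem Lam_le_of_dilation {d : ℕ} {A Ω : Opens (E d)} {t : ℝ} (ht : 0 < t) {b : E d}
    (hsub : ∀ x, dilation ht b x ∈ A → x ∈ Ω) (h : ℕ) :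
    Lam h Ω ≤ ENNReal.ofReal (t ^ 2) * Lam h A := by
  have ht2 : ENNReal.ofReal (t ^ 2) ≠ 0 := (ENNReal.ofReal_pos.2 (by positivity)).ne'
  simp only [Lam, ENNReal.mul_iInf_of_ne ht2 ENNReal.ofReal_ne_top]
  refine le_iInf fun V => le_iInf fun hV => le_iInf fun hVh => ?_
  choose P hP hPv using fun u : V => exists_mem_H20_eq_jetPullback ht hsub (hV u.2)
  let L : V →ₗ[ℝ] H2 Ω :=
    { toFun := P
      map_add' := fun u v => Subtype.ext (by
        rw [hPv, Submodule.coe_add, Submodule.coe_add, map_add, Submodule.coe_add, hPv, hPv])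
      map_smul' := fun c u => Subtype.ext (by
        rw [hPv, Submodule.coe_smul, Submodule.coe_smul, map_smul, RingHom.id_apply,
          Submodule.coe_smul, hPv]) }
  have hL : Function.Injective L := by
    intro u v huv
    have h1 : (P u).1 = (P v).1 := congrArg Subtype.val huv
    rw [hPv, hPv] at h1
    exact Subtype.ext (Subtype.ext (jetPullback_injective ht hsub h1))
  refine iInf_le_of_le (LinearMap.range L) (iInf_le_of_le ?_ (iInf_le_of_le ?_ ?_))
  · rintro _ ⟨u, rfl⟩
    exact hP u
  · rw [LinearMap.finrank_range_of_inj hL, hVh]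
  · refine iSup_le fun v => iSup_le fun hv => iSup_le fun hv0 => ?_
    obtain ⟨u, rfl⟩ := hv
    have hu0 : (u : H2 A) ≠ 0 := by
      rintro hu
      refine hv0 ?_
      rw [Subtype.ext (a2 := (0 : V)) hu, map_zero]
    refine (rayleigh_of_eq_jetPullback ht hsub (hPv u)).trans_le ?_
    gcongr
    exact le_iSup_of_le (u : H2 A) (le_iSup_of_le u.2 (le_iSup_of_le hu0 le_rfl))

end Buckling

end

theorem mainTheorem7 (d : ℕ) (D : Set (Buckling.E d)) (hD : IsCompact D)
    (Ωs : ℕ → TopologicalSpace.Opens (Buckling.E d)) (Ω : TopologicalSpace.Opens (Buckling.E d))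
    (hΩs_convex : ∀ n, Convex ℝ (Ωs n : Set (Buckling.E d)))
    (hΩ_convex : Convex ℝ (Ω : Set (Buckling.E d)))
    (hΩ_nonempty : (Ω : Set (Buckling.E d)).Nonempty)
    (hΩs_subset : ∀ n, (Ωs n : Set (Buckling.E d)) ⊆ D)
    (hΩ_subset : (Ω : Set (Buckling.E d)) ⊆ D)
    (hconv : Filter.Tendsto (fun n => Buckling.hausdorffComplEDist (Ωs n) Ω)
      Filter.atTop (nhds 0))
    (h : ℕ) (hh : 1 ≤ h) :
    Buckling.Lam h Ω ≤ Filter.liminf (fun n => Buckling.Lam h (Ωs n)) Filter.atTop := by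
  obtain ⟨x₀, hx₀⟩ := hΩ_nonempty
  have hdil : ∀ t : ℝ, 1 < t → ENNReal.ofReal ((t ^ 2)⁻¹) * Buckling.Lam h Ω
      ≤ Filter.liminf (fun n => Buckling.Lam h (Ωs n)) Filter.atTop := by
    intro t ht
    have ht0 : 0 < t := by linarith
    refine Filter.le_liminf_of_le (by isBoundedDefault) ?_
    filter_upwards [Buckling.eventually_mem_of_homothety_mem hΩs_convex hconv hx₀ ht] with n hn
    have hle := Buckling.Lam_le_of_dilation ht0 (b := x₀ - t • x₀) (A := Ωs n) (Ω := Ω)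
      (fun x hx => hn x (by
        rw [Buckling.dilation_apply] at hx
        convert hx using 1
        rw [smul_sub]
        abel)) h
    calc ENNReal.ofReal ((t ^ 2)⁻¹) * Buckling.Lam h Ω
        ≤ ENNReal.ofReal ((t ^ 2)⁻¹) * (ENNReal.ofReal (t ^ 2) * Buckling.Lam h (Ωs n)) := by
          gcongr
      _ = Buckling.Lam h (Ωs n) := by
          rw [← mul_assoc, ← ENNReal.ofReal_mul (by positivity),
            inv_mul_cancel₀ (by positivity), ENNReal.ofReal_one, one_mul]
  have hlim : Filter.Tendsto (fun t : ℝ => ENNReal.ofReal ((t ^ 2)⁻¹) * Buckling.Lam h Ω)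
      (nhdsWithin 1 (Set.Ioi 1)) (nhds (Buckling.Lam h Ω)) := by
    have h1 : Filter.Tendsto (fun t : ℝ => (t ^ 2)⁻¹) (nhds 1) (nhds 1) := by
      have : ContinuousAt (fun t : ℝ => (t ^ 2)⁻¹) 1 :=
        (continuousAt_id.pow 2).inv₀ (by simp)
      simpa [ContinuousAt] using this
    have h2 := ENNReal.Tendsto.mul_const (b := Buckling.Lam h Ω)
      (ENNReal.tendsto_ofReal (h1.mono_left (nhdsWithin_le_nhds (s := Set.Ioi 1)))) (Or.inl (by simp))
    simpa using h2
  refine le_of_tendsto hlim ?_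
  filter_upwards [self_mem_nhdsWithin] with t ht using hdil t ht
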